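/- Let $p$ be a prime, let $F$ be a field of characteristic $p$, and let $A$ be a finite-dimensional (associative, not necessarily central) division algebra over $F$. Let $F(x)$ be the field of rational functions in one variable over $F$, and write $A_E = A\otimes_F E$ for a field extension $E/F$. For a field $E$ of characteristic $p$, $\alpha\in E$ and $\beta\in E^\times$, let $$[\alpha,\beta)_{p,E}=E\langle u,y : u^p-u=\alpha,\ y^p=\beta,\ yuy^{-1}=u+1\rangle$$ be the symbol $p$-algebra. (1) Let $\gamma\in F$ and let $K=F[\wp^{-1}(\gamma)]$ be a cyclic field extension of $F$ of degree $p$ generated by a root $\theta$ of $\theta^p-\theta=\gamma$. If $A_K$ is a division algebra, then $A_{F(x)}\otimes_{F(x)}[\gamma,x)_{p,F(x)}$ is a (finite-dimensional) division algebra over $F(x)$. (2) Let $\delta\in F$ and let $L=F[\sqrt[p]{\delta}]$ be a purely inseparable field extension of $F$ of degree $p$ generated by a $p$-th root of $\delta$. If $A_L$ is a division algebra, then $A_{F(x)}\otimes_{F(x)}[x^{-1},\delta)_{p,F(x)}$ is a (finite-dimensional) division algebra over $F(x)$. -/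

import Mathlib

open scoped TensorProduct

/-- `D` is a (finite-dimensional, associative, not necessarily central) division algebra over the
field `F`. -/
structure IsDivisionAlgebra (F : Type*) (D : Type*) [Field F] [Ring D] [Algebra F D] : Prop where
  finiteDimensional : FiniteDimensional F D
  nontrivial : Nontrivial D
  isUnit_of_ne_zero : ∀ a : D, a ≠ 0 → IsUnit a

/-- The defining relations of the symbol `p`-algebra, on the free `F`-algebra on the two generators
`x = ι false` and `y = ι true`. -/
inductive SymbolRel (p : ℕ) {F : Type*} [Field F] (α β : F) :
    FreeAlgebra F Bool → FreeAlgebra F Bool → Prop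
  | artinSchreier : SymbolRel p α β
      (FreeAlgebra.ι F false ^ p - FreeAlgebra.ι F false) (algebraMap F (FreeAlgebra F Bool) α)
  | pow : SymbolRel p α β (FreeAlgebra.ι F true ^ p) (algebraMap F (FreeAlgebra F Bool) β)
  | conj : SymbolRel p α β (FreeAlgebra.ι F true * FreeAlgebra.ι F false)
      ((FreeAlgebra.ι F false + 1) * FreeAlgebra.ι F true)

/-- The symbol `p`-algebra
`[α, β)_{p,F} = F⟨x, y : x ^ p - x = α, y ^ p = β, y x y⁻¹ = x + 1⟩`, for `β ≠ 0`.
As `y` is then invertible by the second relation, the third one is written `y x = (x + 1) y`. -/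
abbrev SymbolAlgebra (p : ℕ) {F : Type*} [Field F] (α β : F) : Type _ :=
  RingQuot (SymbolRel p α β)

/-- `K = F[℘⁻¹(γ)]` is a cyclic field extension of `F` of degree `p`. -/
structure IsCyclicArtinSchreier (p : ℕ) {F : Type*} [Field F] (γ : F) (K : Type*) [Field K]
    [Algebra F K] : Prop where
  isGalois : IsGalois F K
  isCyclic : IsCyclic (K ≃ₐ[F] K)
  finrank_eq : Module.finrank F K = p
  exists_generator : ∃ θ : K, θ ^ p - θ = algebraMap F K γ ∧ IntermediateField.adjoin F {θ} = ⊤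

/-- `L = F[δ^{1/p}]` is a purely inseparable field extension of `F` of degree `p`. -/
structure IsPurelyInseparableRoot (p : ℕ) {F : Type*} [Field F] (δ : F) (L : Type*) [Field L]
    [Algebra F L] : Prop where
  isPurelyInseparable : IsPurelyInseparable F L
  finrank_eq : Module.finrank F L = p
  exists_generator : ∃ θ : L, θ ^ p = algebraMap F L δ ∧ IntermediateField.adjoin F {θ} = ⊤

/-!
Put `B = A_E ⊗_E S ≅ S ⊗_F A` with `E = F(t)` and `S` the symbol algebra, let `D` be the image of
`A_K` in `B`, where `K` is embedded in `S` by one of the two standard generators, and let `z` be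
the other one, so that `z D ⊆ D z + D`. Let `R` be the `F`-subalgebra generated by `D` and `z`; it
contains `F[t]`. If a nonzero `r ∈ R` kills `v`, dividing out its leading coefficient in `D` gives
`z ^ m v ∈ ∑ i < m, D z ^ i v`, so `R v` lies in this space, which has finite dimension over `F`.
But `F[t]` has infinite dimension, and `c ↦ c v` is injective on the field `E` unless `v = 0`;
hence `v = 0`. Clearing denominators in `F[t]`, every element of `B` is a scalar multiple of an
element of `R`, so `B` has no zero divisors, and it has finite dimension over `E`. The powers of
`z` need not be independent over `D`, so no basis of `S` is required.
-/

section OreVariable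

variable {F B : Type*} [CommRing F] [Ring B] [Algebra F B]

/-- `z` is an Ore variable over `D` if `z D ⊆ D z + D`. Then `D` and `z` generate a quotient of an
Ore extension `D[z; σ, δ]`; neither `σ` and `δ` nor the independence of the powers of `z` over `D`
is part of the notion. -/
def IsOreVariable (D : Subalgebra F B) (z : B) : Prop :=
  ∀ d ∈ D, ∃ d₁ ∈ D, ∃ d₀ ∈ D, z * d = d₁ * z + d₀

/-- The left `D`-module `∑ i < n, D z ^ i v` of the values at `v` of the polynomials in `z` of
degree less than `n` with left coefficients in `D`. -/
def powSpan (D : Subalgebra F B) (z v : B) (n : ℕ) : Submodule D B :=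
  Submodule.span D ((fun i ↦ z ^ i * v) '' Set.Iio n)

variable {D : Subalgebra F B} {z v b : B} {n : ℕ}

theorem pow_mul_mem_powSpan {i : ℕ} (hi : i < n) : z ^ i * v ∈ powSpan D z v n :=
  Submodule.subset_span ⟨i, hi, rfl⟩

theorem powSpan_mono (D : Subalgebra F B) (z v : B) : Monotone (powSpan D z v) :=
  fun _ _ h ↦ Submodule.span_mono (Set.image_mono (Set.Iio_subset_Iio h))

theorem mem_powSpan_succ :
    b ∈ powSpan D z v (n + 1) ↔ ∃ d : D, ∃ l ∈ powSpan D z v n, b = d * (z ^ n * v) + l := by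
  rw [powSpan, ← Order.succ_eq_add_one, Order.Iio_succ_eq_insert, Set.image_insert_eq,
    Submodule.mem_span_insert]
  rfl

theorem mul_mem_powSpan_of_mem_powSpan_one (hb : b ∈ powSpan D z 1 n) :
    b * v ∈ powSpan D z v n := by
  have h := Submodule.mem_map_of_mem (f := LinearMap.mulRight D v) hb
  simpa only [powSpan, Submodule.map_span, Set.image_image, LinearMap.mulRight_apply,
    mul_one] using h

theorem finite_powSpan [Module.Finite F D] (z v : B) (n : ℕ) :
    Module.Finite F (powSpan D z v n) := by
  have : Module.Finite D (powSpan D z v n) :=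
    .span_of_finite D ((Set.finite_Iio n).image _)
  exact .trans D _

theorem mul_mem_of_mem_adjoin_insert {V : Submodule D B} (hz : ∀ x ∈ V, z * x ∈ V)
    {r : B} (hr : r ∈ Algebra.adjoin F (insert z (D : Set B))) (hb : b ∈ V) : r * b ∈ V := by
  induction hr using Algebra.adjoin_induction generalizing b with
  | mem a ha =>
    rcases ha with rfl | ha
    · exact hz b hb
    · exact V.smul_mem (⟨a, ha⟩ : D) hb
  | algebraMap c => exact V.smul_mem (algebraMap F D c) hb
  | add x y _ _ hx hy => rw [add_mul]; exact add_mem (hx hb) (hy hb)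
  | mul x y _ _ hx hy => rw [mul_assoc]; exact hx (hy hb)

namespace IsOreVariable

theorem of_adjoin {s : Set B} (h : ∀ d ∈ s, ∃ d₁ ∈ Algebra.adjoin F s, ∃ d₀ ∈ Algebra.adjoin F s,
    z * d = d₁ * z + d₀) : IsOreVariable (Algebra.adjoin F s) z := by
  intro d hd
  induction hd using Algebra.adjoin_induction with
  | mem d hd => exact h d hd
  | algebraMap c =>
    exact ⟨_, algebraMap_mem _ c, 0, zero_mem _, by rw [add_zero, Algebra.commutes]⟩
  | add x y _ _ hx hy =>
    obtain ⟨x₁, hx₁, x₀, hx₀, hx⟩ := hx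
    obtain ⟨y₁, hy₁, y₀, hy₀, hy⟩ := hy
    refine ⟨x₁ + y₁, add_mem hx₁ hy₁, x₀ + y₀, add_mem hx₀ hy₀, ?_⟩
    rw [mul_add, hx, hy, add_mul, add_add_add_comm]
  | mul x y _ hyD hx hy =>
    obtain ⟨x₁, hx₁, x₀, hx₀, hx⟩ := hx
    obtain ⟨y₁, hy₁, y₀, hy₀, hy⟩ := hy
    refine ⟨x₁ * y₁, mul_mem hx₁ hy₁, x₁ * y₀ + x₀ * y,
      add_mem (mul_mem hx₁ hy₀) (mul_mem hx₀ hyD), ?_⟩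
    rw [← mul_assoc, hx, add_mul, mul_assoc, hy, mul_add, mul_assoc, add_assoc]

theorem mul_mem_powSpan (hz : IsOreVariable D z) (hb : b ∈ powSpan D z v n) :
    z * b ∈ powSpan D z v (n + 1) := by
  induction hb using Submodule.span_induction with
  | mem x hx =>
    obtain ⟨i, hi, rfl⟩ := hx
    simpa only [pow_succ', mul_assoc] using pow_mul_mem_powSpan (Nat.succ_lt_succ hi)
  | zero => simp
  | add x y _ _ hx hy => rw [mul_add]; exact add_mem hx hy
  | smul d x hx hzx =>
    obtain ⟨d₁, hd₁, d₀, hd₀, h⟩ := hz d d.2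
    have hzd : z * (d • x) = (⟨d₁, hd₁⟩ : D) • (z * x) + (⟨d₀, hd₀⟩ : D) • x := by
      simp only [Subalgebra.smul_def, smul_eq_mul]
      rw [← mul_assoc, h, add_mul, mul_assoc]
    rw [hzd]
    exact add_mem (Submodule.smul_mem _ _ hzx)
      (Submodule.smul_mem _ _ (powSpan_mono D z v n.le_succ hx))

theorem exists_mem_powSpan (hz : IsOreVariable D z) {r : B}
    (hr : r ∈ Algebra.adjoin F (insert z (D : Set B))) : ∃ n, r ∈ powSpan D z 1 n := by
  have hdir : Directed (· ≤ ·) (powSpan D z 1) := (powSpan_mono D z 1).directed_le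
  rw [← Submodule.mem_iSup_of_directed _ hdir, ← mul_one r]
  refine mul_mem_of_mem_adjoin_insert (fun x hx ↦ ?_) hr ?_
  · obtain ⟨n, hn⟩ := (Submodule.mem_iSup_of_directed _ hdir).1 hx
    exact Submodule.mem_iSup_of_mem (n + 1) (hz.mul_mem_powSpan hn)
  · refine Submodule.mem_iSup_of_mem 1 ?_
    simpa using pow_mul_mem_powSpan (D := D) (z := z) (v := 1) one_pos

theorem mul_mem_powSpan_of_mem_adjoin (hz : IsOreVariable D z)
    (hn : z ^ n * v ∈ powSpan D z v n) {r : B}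
    (hr : r ∈ Algebra.adjoin F (insert z (D : Set B))) : r * v ∈ powSpan D z v n := by
  have hle {b : B} (hb : b ∈ powSpan D z v (n + 1)) : b ∈ powSpan D z v n := by
    obtain ⟨d, l, hl, rfl⟩ := mem_powSpan_succ.1 hb
    exact add_mem (Submodule.smul_mem _ d hn) hl
  refine mul_mem_of_mem_adjoin_insert (fun x hx ↦ hle (hz.mul_mem_powSpan hx)) hr (hle ?_)
  simpa using pow_mul_mem_powSpan (D := D) (z := z) (v := v) n.succ_pos

end IsOreVariable

/-- The leading coefficient of an annihilator of `v` is invertible, hence can be divided out. -/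
theorem exists_pow_mul_mem_powSpan_of_mul_eq_zero (hD : ∀ d : D, d ≠ 0 → IsUnit d) {r : B}
    (hr : r ∈ powSpan D z 1 n) (hr₀ : r ≠ 0) (hrv : r * v = 0) :
    ∃ m, z ^ m * v ∈ powSpan D z v m := by
  induction n with
  | zero => exact absurd (by simpa [powSpan] using hr) hr₀
  | succ n ih =>
    obtain ⟨d, l, hl, rfl⟩ := mem_powSpan_succ.1 hr
    rcases eq_or_ne d 0 with rfl | hd
    · exact ih (by simpa using hl)
    obtain ⟨c, hc⟩ := (hD d hd).exists_left_inv
    have hdl : (d : B) * (z ^ n * v) = -(l * v) := by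
      rw [mul_one, add_mul, mul_assoc] at hrv
      exact eq_neg_of_add_eq_zero_left hrv
    have hlead : z ^ n * v = c • -(l * v) := by
      rw [← hdl, Subalgebra.smul_def, smul_eq_mul, ← mul_assoc, ← MulMemClass.coe_mul, hc,
        OneMemClass.coe_one, one_mul]
    exact ⟨n, hlead ▸ Submodule.smul_mem _ c (neg_mem (mul_mem_powSpan_of_mem_powSpan_one hl))⟩

end OreVariable

section CentralLocalization

variable {F E B : Type*} [Field F] [Field E] [Algebra F E] [Ring B] [Algebra F B] [Algebra E B]
  {D : Subalgebra F B} {z : B}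

theorem eq_zero_of_finiteDimensional_of_forall_smul_mem {M : Type*} [AddCommGroup M]
    [Module F M] [Module E M] [IsScalarTower F E M] {C : Subalgebra F E}
    (hC : ¬ Module.Finite F C) {W : Submodule F M} [Module.Finite F W] {v : M}
    (hv : ∀ c ∈ C, c • v ∈ W) : v = 0 := by
  by_contra hv₀
  let g : C →ₗ[F] W :=
    (((LinearMap.toSpanSingleton E M v).restrictScalars F).comp C.val.toLinearMap).codRestrict W
      fun c ↦ hv c c.2
  have hg : Function.Injective g := fun c c' h ↦
    Subtype.ext (smul_left_injective E hv₀ (congrArg Subtype.val h))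
  exact hC (.of_injective g hg)

theorem exists_smul_mem_adjoin_of_isFractionRing {s : Set B}
    {C : Subalgebra F E} [IsFractionRing C E] (hCs : ∀ c ∈ C, algebraMap E B c ∈ Algebra.adjoin F s)
    {b : B} (hb : b ∈ Algebra.adjoin E s) : ∃ c : E, c ≠ 0 ∧ c • b ∈ Algebra.adjoin F s := by
  rw [← Subalgebra.mem_toSubmodule, Algebra.adjoin_eq_span] at hb
  obtain ⟨c, hc⟩ := multiple_mem_span_of_mem_localization_span (nonZeroDivisors C) E _ b hb
  refine ⟨c, by simp, ?_⟩
  have hcb : ((c : C) : E) • b ∈ Algebra.adjoin C s := by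
    rwa [← Subalgebra.mem_toSubmodule, Algebra.adjoin_eq_span]
  generalize ((c : C) : E) • b = x at hcb
  induction hcb using Algebra.adjoin_induction with
  | mem a ha => exact Algebra.subset_adjoin ha
  | algebraMap a => exact hCs a a.2
  | add _ _ _ _ hx hy => exact add_mem hx hy
  | mul _ _ _ _ hx hy => exact mul_mem hx hy

variable [IsScalarTower F E B]

theorem IsOreVariable.eq_zero_of_mul_eq_zero [Module.Finite F D] (hz : IsOreVariable D z)
    (hD : ∀ d : D, d ≠ 0 → IsUnit d) {C : Subalgebra F E} (hC : ¬ Module.Finite F C)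
    (hCz : ∀ c ∈ C, algebraMap E B c ∈ Algebra.adjoin F (insert z (D : Set B))) {r v : B}
    (hr : r ∈ Algebra.adjoin F (insert z (D : Set B))) (hr₀ : r ≠ 0) (hrv : r * v = 0) :
    v = 0 := by
  obtain ⟨n, hrn⟩ := hz.exists_mem_powSpan hr
  obtain ⟨m, hm⟩ := exists_pow_mul_mem_powSpan_of_mul_eq_zero hD hrn hr₀ hrv
  have : Module.Finite F ((powSpan D z v m).restrictScalars F) := finite_powSpan z v m
  refine eq_zero_of_finiteDimensional_of_forall_smul_mem hC
    (W := (powSpan D z v m).restrictScalars F) fun c hc ↦ ?_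
  rw [Algebra.smul_def]
  exact hz.mul_mem_powSpan_of_mem_adjoin hm (hCz c hc)

theorem IsOreVariable.noZeroDivisors [Module.Finite F D] (hz : IsOreVariable D z)
    (hD : ∀ d : D, d ≠ 0 → IsUnit d) {C : Subalgebra F E} [IsFractionRing C E]
    (hC : ¬ Module.Finite F C)
    (hCz : ∀ c ∈ C, algebraMap E B c ∈ Algebra.adjoin F (insert z (D : Set B)))
    (htop : Algebra.adjoin E (insert z (D : Set B)) = ⊤) : NoZeroDivisors B where
  eq_zero_or_eq_zero_of_mul_eq_zero {b v} hbv := by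
    refine or_iff_not_imp_left.2 fun hb ↦ ?_
    obtain ⟨c, hc, hcb⟩ :=
      exists_smul_mem_adjoin_of_isFractionRing hCz (htop ▸ Algebra.mem_top : b ∈ _)
    exact hz.eq_zero_of_mul_eq_zero hD hC hCz hcb (smul_ne_zero hc hb)
      (by rw [smul_mul_assoc, hbv, smul_zero])

end CentralLocalization

section SimpleExtension

variable {F E : Type*} [Field F] [Field E] [Algebra F E] {t : E}

open scoped IntermediateField

theorem not_finite_adjoin_singleton_of_transcendental (ht : Transcendental F t) :
    ¬ Module.Finite F (Algebra.adjoin F {t}) := fun _ ↦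
  ht ((IsIntegral.of_finite F (⟨t, Algebra.self_mem_adjoin_singleton F t⟩ :
    Algebra.adjoin F {t})).map (Algebra.adjoin F {t}).val).isAlgebraic

theorem isFractionRing_adjoin_singleton_of_adjoin_eq_top (htop : F⟮t⟯ = ⊤) :
    IsFractionRing (Algebra.adjoin F {t}) E := by
  refine .of_field _ _ fun x ↦ ?_
  obtain ⟨a, ha, b, hb, h⟩ :=
    IntermediateField.mem_adjoin_iff_div.1 (htop ▸ IntermediateField.mem_top : x ∈ F⟮t⟯)
  exact ⟨⟨a, ha⟩, ⟨b, hb⟩, h⟩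

open Polynomial in
theorem exists_algHom_range_eq_adjoin {K S : Type*} [Field K] [Algebra F K] [Ring S] [Algebra F S]
    {g : F[X]} (hg : g.Monic) (hdeg : g.natDegree = Module.finrank F K) {θ : K}
    (hθ : aeval θ g = 0) (htop : F⟮θ⟯ = ⊤) {w : S} (hw : aeval w g = 0) :
    ∃ ψ : K →ₐ[F] S, ψ.range = Algebra.adjoin F {w} := by
  have hint : IsIntegral F θ := ⟨g, hg, hθ⟩
  have hadj : Algebra.adjoin F {θ} = ⊤ := by
    rw [← IntermediateField.adjoin_simple_toSubalgebra_of_isAlgebraic hint.isAlgebraic, htop,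
      IntermediateField.top_toSubalgebra]
  have hmin : minpoly F θ = g :=
    (eq_of_monic_of_dvd_of_natDegree_le (minpoly.monic hint) hg (minpoly.dvd F θ hθ) (by
      rw [hdeg, ← IntermediateField.adjoin.finrank hint, htop,
        IntermediateField.finrank_top'])).symm
  let pb := PowerBasis.ofAdjoinEqTop hint hadj
  have hgen : pb.gen = θ := PowerBasis.ofAdjoinEqTop_gen hint hadj
  have hroot : aeval w (minpoly F pb.gen) = 0 := by rw [hgen, hmin, hw]
  refine ⟨pb.lift w hroot, ?_⟩
  rw [← Algebra.map_top, ← hadj, AlgHom.map_adjoin, Set.image_singleton, ← hgen, pb.lift_gen]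

end SimpleExtension

section TensorProduct

open scoped IntermediateField

variable {F E K A S : Type*} [Field F] [Field E] [Algebra F E] [Ring K] [Algebra F K] [Ring A]
  [Algebra F A] [Ring S] [Algebra F S]

theorem IsOreVariable.tmul_one {ψ : K →ₐ[F] S} {z : S} (hz : IsOreVariable ψ.range z) :
    IsOreVariable (Algebra.TensorProduct.map ψ (AlgHom.id F A)).range (z ⊗ₜ[F] (1 : A)) := by
  rintro _ ⟨x, rfl⟩
  induction x using TensorProduct.induction_on with
  | zero => exact ⟨0, zero_mem _, 0, zero_mem _, by simp⟩
  | tmul k a =>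
    obtain ⟨_, ⟨k₁, rfl⟩, _, ⟨k₀, rfl⟩, h⟩ := hz (ψ k) ⟨k, rfl⟩
    refine ⟨_, ⟨k₁ ⊗ₜ a, rfl⟩, _, ⟨k₀ ⊗ₜ a, rfl⟩, ?_⟩
    simpa [← TensorProduct.add_tmul] using congrArg (· ⊗ₜ[F] a) h
  | add x y hx hy =>
    obtain ⟨x₁, hx₁, x₀, hx₀, hx⟩ := hx
    obtain ⟨y₁, hy₁, y₀, hy₀, hy⟩ := hy
    refine ⟨x₁ + y₁, add_mem hx₁ hy₁, x₀ + y₀, add_mem hx₀ hy₀, ?_⟩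
    rw [map_add, mul_add, hx, hy, add_mul, add_add_add_comm]

variable [Algebra E S] [IsScalarTower F E S]

theorem adjoin_insert_tmul_one_range_map_eq_top {ψ : K →ₐ[F] S} {z : S}
    (h : Algebra.adjoin E (insert z (ψ.range : Set S)) = ⊤) :
    Algebra.adjoin E (insert (z ⊗ₜ[F] (1 : A))
      ((Algebra.TensorProduct.map ψ (AlgHom.id F A)).range : Set (S ⊗[F] A))) = ⊤ := by
  set T := Algebra.adjoin E (insert (z ⊗ₜ[F] (1 : A))
    ((Algebra.TensorProduct.map ψ (AlgHom.id F A)).range : Set (S ⊗[F] A)))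
  have hrange (x : K ⊗[F] A) : Algebra.TensorProduct.map ψ (AlgHom.id F A) x ∈ T :=
    Algebra.subset_adjoin (Set.mem_insert_of_mem _ ⟨x, rfl⟩)
  have hS : ⊤ ≤ T.comap (Algebra.TensorProduct.includeLeft : S →ₐ[E] S ⊗[F] A) := by
    rw [← h, Algebra.adjoin_le_iff]
    rintro _ (rfl | ⟨k, rfl⟩)
    · exact Algebra.subset_adjoin (Set.mem_insert _ _)
    · simpa using hrange (k ⊗ₜ 1)
  refine eq_top_iff.2 fun x _ ↦ ?_
  induction x using TensorProduct.induction_on with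
  | zero => exact zero_mem T
  | tmul s a =>
    have hs : s ⊗ₜ[F] (1 : A) ∈ T := hS (Algebra.mem_top (x := s))
    have ha : (1 : S) ⊗ₜ[F] a ∈ T := by simpa using hrange (1 ⊗ₜ a)
    simpa using mul_mem hs ha
  | add x y hx hy => exact add_mem (hx trivial) (hy trivial)

theorem noZeroDivisors_tensorProduct [Module.Finite F K] [Module.Finite F A]
    (hKA : ∀ a : K ⊗[F] A, a ≠ 0 → IsUnit a) {ψ : K →ₐ[F] S} {z : S}
    (hz : IsOreVariable ψ.range z) (hS : Algebra.adjoin E (insert z (ψ.range : Set S)) = ⊤)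
    {t : E} (ht : Transcendental F t) (htop : F⟮t⟯ = ⊤)
    (htz : algebraMap E S t ∈ Algebra.adjoin F {z}) : NoZeroDivisors (S ⊗[F] A) := by
  have := isFractionRing_adjoin_singleton_of_adjoin_eq_top htop
  have hD (d : (Algebra.TensorProduct.map ψ (AlgHom.id F A)).range) (hd : d ≠ 0) : IsUnit d := by
    obtain ⟨_, a, rfl⟩ := d
    exact (hKA a (by rintro rfl; exact hd (Subtype.ext (map_zero _)))).map
      (Algebra.TensorProduct.map ψ (AlgHom.id F A)).rangeRestrict
  have : Module.Finite F (Algebra.TensorProduct.map ψ (AlgHom.id F A)).range :=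
    .of_surjective _
      (Algebra.TensorProduct.map ψ (AlgHom.id F A)).toLinearMap.surjective_rangeRestrict
  refine hz.tmul_one.noZeroDivisors hD (not_finite_adjoin_singleton_of_transcendental ht)
    (fun c hc ↦ ?_) (adjoin_insert_tmul_one_range_map_eq_top hS)
  have hz_le : Algebra.adjoin F {z} ≤ (Algebra.adjoin F (insert (z ⊗ₜ[F] (1 : A))
      ((Algebra.TensorProduct.map ψ (AlgHom.id F A)).range : Set (S ⊗[F] A)))).comap
        Algebra.TensorProduct.includeLeft :=
    Algebra.adjoin_le (Set.singleton_subset_iff.2 (Algebra.subset_adjoin (Set.mem_insert _ _)))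
  have ht_le : Algebra.adjoin F {t} ≤
      (Algebra.adjoin F {z}).comap (IsScalarTower.toAlgHom F E S) :=
    Algebra.adjoin_le (Set.singleton_subset_iff.2 htz)
  exact hz_le (ht_le hc)

end TensorProduct

section ArtinSchreierPolynomial

open Polynomial

variable {F : Type*} [Field F] {p : ℕ}

theorem natDegree_X_pow_sub_X_sub_C (hp : 1 < p) (a : F) :
    (X ^ p - X - C a : F[X]).natDegree = p := by
  rw [natDegree_sub_C, FiniteField.X_pow_card_sub_X_natDegree_eq F hp]

theorem monic_X_pow_sub_X_sub_C (hp : 1 < p) (a : F) : (X ^ p - X - C a : F[X]).Monic := by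
  rw [sub_sub]
  exact monic_X_pow_sub (by rw [degree_X_add_C]; exact_mod_cast hp)

theorem exists_pow_sub_self_eq [IsAlgClosed F] (hp : 1 < p) (a : F) : ∃ θ : F, θ ^ p - θ = a := by
  obtain ⟨θ, hθ⟩ := IsAlgClosed.exists_root (X ^ p - X - C a) (by
    rw [degree_eq_natDegree (monic_X_pow_sub_X_sub_C hp a).ne_zero,
      natDegree_X_pow_sub_X_sub_C hp]
    exact_mod_cast (zero_lt_one.trans hp).ne')
  exact ⟨θ, by simpa [sub_eq_zero] using hθ⟩

end ArtinSchreierPolynomial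

namespace SymbolAlgebra

variable (p : ℕ) {E : Type*} [Field E] (α β : E)

/-- The generator `u` of `[α, β)`, with `u ^ p - u = α`. -/
def u : SymbolAlgebra p α β :=
  RingQuot.mkAlgHom E (SymbolRel p α β) (FreeAlgebra.ι E false)

/-- The generator `y` of `[α, β)`, with `y ^ p = β`. -/
def y : SymbolAlgebra p α β :=
  RingQuot.mkAlgHom E (SymbolRel p α β) (FreeAlgebra.ι E true)

theorem u_pow_sub_u : u p α β ^ p - u p α β = algebraMap E _ α := by
  simpa [u] using RingQuot.mkAlgHom_rel E (SymbolRel.artinSchreier (p := p) (α := α) (β := β))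

theorem y_pow : y p α β ^ p = algebraMap E _ β := by
  simpa [y] using RingQuot.mkAlgHom_rel E (SymbolRel.pow (p := p) (α := α) (β := β))

theorem y_mul_u : y p α β * u p α β = (u p α β + 1) * y p α β := by
  simpa [u, y] using RingQuot.mkAlgHom_rel E (SymbolRel.conj (p := p) (α := α) (β := β))

theorem adjoin_u_y : Algebra.adjoin E {u p α β, y p α β} = ⊤ := by
  have h := congrArg (Subalgebra.map (RingQuot.mkAlgHom E (SymbolRel p α β)))
    (FreeAlgebra.adjoin_range_ι E Bool)
  rwa [AlgHom.map_adjoin, Algebra.map_top,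
    (AlgHom.range_eq_top _).2 (RingQuot.mkAlgHom_surjective E _), ← Set.range_comp,
    Bool.range_eq] at h

theorem adjoin_insert_y (F : Type*) [CommRing F] [Algebra F (SymbolAlgebra p α β)] :
    Algebra.adjoin E (insert (y p α β)
      (Algebra.adjoin F {u p α β} : Set (SymbolAlgebra p α β))) = ⊤ := by
  rw [eq_top_iff, ← adjoin_u_y, Set.pair_comm]
  exact Algebra.adjoin_mono (Set.insert_subset_insert Algebra.subset_adjoin)

theorem adjoin_insert_u (F : Type*) [CommRing F] [Algebra F (SymbolAlgebra p α β)] :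
    Algebra.adjoin E (insert (u p α β)
      (Algebra.adjoin F {y p α β} : Set (SymbolAlgebra p α β))) = ⊤ := by
  rw [eq_top_iff, ← adjoin_u_y]
  exact Algebra.adjoin_mono (Set.insert_subset_insert Algebra.subset_adjoin)

theorem isOreVariable_y (F : Type*) [CommRing F] [Algebra F (SymbolAlgebra p α β)] :
    IsOreVariable (Algebra.adjoin F {u p α β}) (y p α β) := by
  refine .of_adjoin ?_
  rintro _ rfl
  have hu := Algebra.self_mem_adjoin_singleton F (u p α β)
  exact ⟨_, add_mem hu (one_mem _), 0, zero_mem _, by rw [y_mul_u, add_zero]⟩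

theorem isOreVariable_u (F : Type*) [CommRing F] [Algebra F (SymbolAlgebra p α β)] :
    IsOreVariable (Algebra.adjoin F {y p α β}) (u p α β) := by
  refine .of_adjoin ?_
  rintro _ rfl
  have hy := Algebra.self_mem_adjoin_singleton F (y p α β)
  refine ⟨_, hy, _, neg_mem hy, ?_⟩
  rw [y_mul_u, add_mul, one_mul, add_neg_cancel_right]

theorem finite (hp : 1 < p) : Module.Finite E (SymbolAlgebra p α β) := by
  have hint : IsIntegral E (u p α β) :=
    ⟨_, monic_X_pow_sub_X_sub_C hp α, by simp [u_pow_sub_u]⟩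
  let D := Algebra.adjoin E {u p α β}
  have : Module.Finite E D := .of_fg hint.fg_adjoin_singleton
  have hy : y p α β ^ p * 1 ∈ powSpan D (y p α β) 1 p := by
    have h := Submodule.smul_mem _ (algebraMap E D β)
      (pow_mul_mem_powSpan (D := D) (z := y p α β) (v := 1) (zero_lt_one.trans hp))
    simpa [Algebra.smul_def, y_pow] using h
  have := finite_powSpan (D := D) (y p α β) 1 p
  refine .of_surjective ((powSpan D (y p α β) 1 p).subtype.restrictScalars E) fun b ↦
    ⟨⟨b, ?_⟩, rfl⟩
  simpa using (isOreVariable_y p α β E).mul_mem_powSpan_of_mem_adjoin hy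
    (adjoin_insert_y p α β E ▸ Algebra.mem_top : b ∈ _)

variable {p α β}

/-- The homomorphism out of `[α, β)` given by two elements satisfying the defining relations. -/
def lift {S : Type*} [Ring S] [Algebra E S] (U Y : S) (hU : U ^ p - U = algebraMap E S α)
    (hY : Y ^ p = algebraMap E S β) (hYU : Y * U = (U + 1) * Y) : SymbolAlgebra p α β →ₐ[E] S :=
  RingQuot.liftAlgHom E ⟨FreeAlgebra.lift E fun b ↦ bif b then Y else U, by
    rintro _ _ (_ | _ | _) <;> simp [hU, hY, hYU]⟩

theorem funLeft_add_one_pow (R M : Type*) [Semiring R] [AddCommMonoid M] [Module R M] (n : ℕ) :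
    (LinearMap.funLeft R M (· + 1 : ZMod p → ZMod p) : Module.End R (ZMod p → M)) ^ n =
      LinearMap.funLeft R M (· + (n : ZMod p)) := by
  induction n with
  | zero => ext; simp [LinearMap.funLeft_apply]
  | succ n ih =>
    ext v i
    simp [pow_succ, ih, LinearMap.funLeft_apply, add_assoc]

/-- `[α, β)` acts on functions `ZMod p → C`: `u` multiplies by `i ↦ θ + i`, and `y` translates by
`1` and multiplies by `η`. -/
theorem nontrivial_of_roots [Fact p.Prime] {C : Type*} [CommRing C] [Nontrivial C] [CharP C p]
    [Algebra E C] {θ η : C} (hθ : θ ^ p - θ = algebraMap E C α) (hη : η ^ p = algebraMap E C β) :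
    Nontrivial (SymbolAlgebra p α β) := by
  let c : ZMod p → C := fun i ↦ θ + ZMod.castHom dvd_rfl C i
  let T : Module.End C (ZMod p → C) := LinearMap.funLeft C C (· + 1)
  have hc : c ^ p - c = algebraMap E (ZMod p → C) α := by
    ext i
    simp only [c, Pi.sub_apply, Pi.pow_apply, Pi.algebraMap_apply]
    rw [add_pow_char, ← map_pow, ZMod.pow_card, add_sub_add_right_eq_sub, hθ]
  have hU : Algebra.lmul C (ZMod p → C) c ^ p - Algebra.lmul C (ZMod p → C) c =
      algebraMap E _ α := by
    rw [← map_pow, ← map_sub, hc]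
    ext; simp [Algebra.algebraMap_eq_smul_one]
  have hY : (η • T) ^ p = algebraMap E _ β := by
    rw [smul_pow, hη, funLeft_add_one_pow]
    ext; simp [LinearMap.funLeft_apply]
  have hYU : (η • T) * Algebra.lmul C (ZMod p → C) c =
      (Algebra.lmul C (ZMod p → C) c + 1) * (η • T) := by
    refine LinearMap.ext fun v ↦ funext fun i ↦ ?_
    change η * (c (i + 1) * v (i + 1)) = c i * (η * v (i + 1)) + η * v (i + 1)
    simp only [c, map_add, map_one]
    ring
  exact (lift _ _ hU hY hYU).toRingHom.domain_nontrivial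

theorem nontrivial [Fact p.Prime] [CharP E p] : Nontrivial (SymbolAlgebra p α β) := by
  let C := AlgebraicClosure E
  have hp := (Fact.out : p.Prime)
  have : CharP C p := charP_of_injective_algebraMap (algebraMap E C).injective p
  obtain ⟨θ, hθ⟩ := exists_pow_sub_self_eq hp.one_lt (algebraMap E C α)
  obtain ⟨η, hη⟩ := IsAlgClosed.exists_pow_nat_eq (algebraMap E C β) hp.pos
  exact nontrivial_of_roots hθ hη

end SymbolAlgebra

section DivisionAlgebra

open scoped IntermediateField

variable {F E K A S : Type*} [Field F] [Field E] [Algebra F E] [Ring A] [Algebra F A] [Ring S]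
  [Algebra F S] [Algebra E S] [IsScalarTower F E S]

theorem isDivisionAlgebra_of_noZeroDivisors {D : Type*} [Ring D] [Algebra F D] [Module.Finite F D]
    [Nontrivial D] [NoZeroDivisors D] : IsDivisionAlgebra F D :=
  have : IsDomain D := NoZeroDivisors.to_isDomain D
  ⟨inferInstance, inferInstance, fun _ ↦ FiniteDimensional.isUnit F⟩

/-- The identification of `A_E ⊗_E S` with `S ⊗_F A`. The factor `S` moves to the left because
`TensorProduct` carries the scalar action of its left factor. -/
noncomputable def tensorBaseChangeEquiv : (E ⊗[F] A) ⊗[E] S ≃ₐ[E] S ⊗[F] A :=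
  (Algebra.TensorProduct.comm E _ _).trans <|
    (Algebra.TensorProduct.assoc F E E S E A).symm.trans <|
      Algebra.TensorProduct.congr (Algebra.TensorProduct.rid E E S) .refl

theorem isDivisionAlgebra_tensorProduct [Ring K] [Algebra F K] [Module.Finite F K]
    [Module.Finite E S] [Nontrivial S] (hA : IsDivisionAlgebra F A)
    (hKA : ∀ a : K ⊗[F] A, a ≠ 0 → IsUnit a) {ψ : K →ₐ[F] S} {z : S}
    (hz : IsOreVariable ψ.range z) (hS : Algebra.adjoin E (insert z (ψ.range : Set S)) = ⊤)
    {t : E} (ht : Transcendental F t) (htop : F⟮t⟯ = ⊤)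
    (htz : algebraMap E S t ∈ Algebra.adjoin F {z}) :
    IsDivisionAlgebra E ((E ⊗[F] A) ⊗[E] S) := by
  have := hA.finiteDimensional
  have := hA.nontrivial
  have : Nontrivial (E ⊗[F] A) := inferInstance
  have : NoZeroDivisors (S ⊗[F] A) := noZeroDivisors_tensorProduct hKA hz hS ht htop htz
  have : NoZeroDivisors ((E ⊗[F] A) ⊗[E] S) :=
    MulEquiv.noZeroDivisors (S ⊗[F] A) (tensorBaseChangeEquiv (E := E)).toMulEquiv
  exact isDivisionAlgebra_of_noZeroDivisors

end DivisionAlgebra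

section SymbolTensor

open Polynomial
open scoped IntermediateField

variable {F E K A : Type*} [Field F] [Field E] [Algebra F E] [Field K] [Algebra F K] [Ring A]
  [Algebra F A] {p : ℕ} [Fact p.Prime] [CharP F p] {t : E}

theorem IsCyclicArtinSchreier.isDivisionAlgebra_tensor_symbolAlgebra {γ : F}
    (hK : IsCyclicArtinSchreier p γ K) (hA : IsDivisionAlgebra F A)
    (hKA : IsDivisionAlgebra K (K ⊗[F] A)) (ht : Transcendental F t) (htop : F⟮t⟯ = ⊤) :
    IsDivisionAlgebra E ((E ⊗[F] A) ⊗[E] SymbolAlgebra p (algebraMap F E γ) t) := by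
  have hp : p.Prime := Fact.out
  have : CharP E p := charP_of_injective_algebraMap (algebraMap F E).injective p
  have : Module.Finite F K := Module.finite_of_finrank_pos (hK.finrank_eq ▸ hp.pos)
  have := SymbolAlgebra.finite p (algebraMap F E γ) t hp.one_lt
  have := SymbolAlgebra.nontrivial (p := p) (α := algebraMap F E γ) (β := t)
  have hu := SymbolAlgebra.u_pow_sub_u p (algebraMap F E γ) t
  rw [← IsScalarTower.algebraMap_apply] at hu
  obtain ⟨θ, hθ, hθtop⟩ := hK.exists_generator
  obtain ⟨ψ, hψ⟩ := exists_algHom_range_eq_adjoin (monic_X_pow_sub_X_sub_C hp.one_lt γ)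
    (by rw [natDegree_X_pow_sub_X_sub_C hp.one_lt, hK.finrank_eq]) (by simp [hθ]) hθtop
    (by simp [hu] : aeval (SymbolAlgebra.u p (algebraMap F E γ) t) (X ^ p - X - C γ) = 0)
  refine isDivisionAlgebra_tensorProduct hA hKA.isUnit_of_ne_zero
    (hψ ▸ SymbolAlgebra.isOreVariable_y p _ t F) (hψ ▸ SymbolAlgebra.adjoin_insert_y p _ t F)
    ht htop ?_
  rw [← SymbolAlgebra.y_pow]
  exact pow_mem (Algebra.self_mem_adjoin_singleton F _) p

theorem IsPurelyInseparableRoot.isDivisionAlgebra_tensor_symbolAlgebra {δ : F}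
    (hK : IsPurelyInseparableRoot p δ K) (hA : IsDivisionAlgebra F A)
    (hKA : IsDivisionAlgebra K (K ⊗[F] A)) (ht : Transcendental F t) (htop : F⟮t⟯ = ⊤) :
    IsDivisionAlgebra E ((E ⊗[F] A) ⊗[E] SymbolAlgebra p t (algebraMap F E δ)) := by
  have hp : p.Prime := Fact.out
  have : CharP E p := charP_of_injective_algebraMap (algebraMap F E).injective p
  have : Module.Finite F K := Module.finite_of_finrank_pos (hK.finrank_eq ▸ hp.pos)
  have := SymbolAlgebra.finite p t (algebraMap F E δ) hp.one_lt
  have := SymbolAlgebra.nontrivial (p := p) (α := t) (β := algebraMap F E δ)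
  have hy := SymbolAlgebra.y_pow p t (algebraMap F E δ)
  rw [← IsScalarTower.algebraMap_apply] at hy
  obtain ⟨θ, hθ, hθtop⟩ := hK.exists_generator
  obtain ⟨ψ, hψ⟩ := exists_algHom_range_eq_adjoin (monic_X_pow_sub_C δ hp.ne_zero)
    (by rw [natDegree_X_pow_sub_C, hK.finrank_eq]) (by simp [hθ]) hθtop
    (by simp [hy] : aeval (SymbolAlgebra.y p t (algebraMap F E δ)) (X ^ p - C δ) = 0)
  refine isDivisionAlgebra_tensorProduct hA hKA.isUnit_of_ne_zero
    (hψ ▸ SymbolAlgebra.isOreVariable_u p t _ F) (hψ ▸ SymbolAlgebra.adjoin_insert_u p t _ F)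
    ht htop ?_
  rw [← SymbolAlgebra.u_pow_sub_u]
  have hu := Algebra.self_mem_adjoin_singleton F (SymbolAlgebra.u p t (algebraMap F E δ))
  exact sub_mem (pow_mem hu p) hu

theorem transcendental_ratFunc_X_inv : Transcendental F (RatFunc.X : RatFunc F)⁻¹ :=
  fun h ↦ RatFunc.transcendental_X (inv_inv (RatFunc.X : RatFunc F) ▸ h.inv)

theorem adjoin_ratFunc_X_inv : F⟮(RatFunc.X : RatFunc F)⁻¹⟯ = ⊤ := by
  rw [eq_top_iff, ← RatFunc.adjoin_X, IntermediateField.adjoin_simple_le_iff, ← inv_mem_iff]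
  exact IntermediateField.mem_adjoin_simple_self F _

end SymbolTensor

theorem mainTheorem8 {F : Type*} [Field F] (p : ℕ) [Fact p.Prime] [CharP F p]
    {A : Type*} [Ring A] [Algebra F A] (hA : IsDivisionAlgebra F A) :
    (∀ (γ : F) (K : Type*) [Field K] [Algebra F K], IsCyclicArtinSchreier p γ K →
      IsDivisionAlgebra K (K ⊗[F] A) →
      IsDivisionAlgebra (RatFunc F)
        ((RatFunc F ⊗[F] A) ⊗[RatFunc F]
          SymbolAlgebra p (algebraMap F (RatFunc F) γ) (RatFunc.X : RatFunc F))) ∧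
    (∀ (δ : F) (L : Type*) [Field L] [Algebra F L], IsPurelyInseparableRoot p δ L →
      IsDivisionAlgebra L (L ⊗[F] A) →
      IsDivisionAlgebra (RatFunc F)
        ((RatFunc F ⊗[F] A) ⊗[RatFunc F]
          SymbolAlgebra p ((RatFunc.X : RatFunc F)⁻¹) (algebraMap F (RatFunc F) δ))) :=
  ⟨fun _ _ _ _ hK hKA ↦ hK.isDivisionAlgebra_tensor_symbolAlgebra hA hKA
    RatFunc.transcendental_X RatFunc.adjoin_X,
  fun _ _ _ _ hL hLA ↦ hL.isDivisionAlgebra_tensor_symbolAlgebra hA hLA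
    transcendental_ratFunc_X_inv adjoin_ratFunc_X_inv⟩
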